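/- Let $n\ge 0$ and $d\ge 3$ be integers and let $S^d(\mathbb R^n)$ be the space of real symmetric $n\times\cdots\times n$ tensors of order $d$. Put $$V_{\mathrm{diag}}=\{T\in S^d(\mathbb R^n) : T_{i_1\dots i_d}\ne 0 \text{ only if } i_1=\dots=i_d\},\qquad V_{\mathrm{pmi}}=\{T\in S^d(\mathbb R^n) : T_{ij\dots j}=0 \text{ for all } i\ne j\},$$ and let $V$ be a linear space with $V_{\mathrm{diag}}\subseteq V\subseteq V_{\mathrm{pmi}}$. For a random vector $z$ in $\mathbb R^n$ with finite moments of order $d$, let $\kappa_d(z)\in S^d(\mathbb R^n)$ be its $d$-th cumulant tensor, with entries $$\kappa_d(z)_{i_1\dots i_d}=\sum_{\pi}(-1)^{|\pi|-1}(|\pi|-1)!\prod_{B\in\pi}\mathbb E\Big(\prod_{k\in B}z_{i_k}\Big),$$ the sum being over all set partitions $\pi$ of $\{1,\dots,d\}$. **Theorem 1.3.** There is a real polynomial $p$ in the entries of a tensor, not vanishing identically on $V$ (and depending only on $n$, $d$, $V$), such that the following holds. Let $x=As$, where $A\in\mathbb R^{n\times n}$ is invertible and $s$ is a random vector with finite moments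 of order $d$, $\operatorname{Cov}(s)=I$, $\kappa_d(s)\in V$ and $p(\kappa_d(s))\ne 0$ (that is, $\kappa_d(s)$ is sufficiently general in $V$). Then $A$ is identifiable from $\kappa_d(x)$ together with the covariance matrix $\operatorname{Cov}(x)$, up to permutation and sign flips of columns: if $B\in\mathbb R^{n\times n}$ is invertible and $s'$ is any random vector, possibly on another probability space, with finite moments of order $d$, $\operatorname{Cov}(s')=I$ and $\kappa_d(s')\in V$, such that $\operatorname{Cov}(Bs')=\operatorname{Cov}(As)$ and $\kappa_d(Bs')=\kappa_d(As)$, then $B$ is obtained from $A$ by permuting columns and changing the signs of some columns. -/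

import Mathlib

open MeasureTheory

namespace ComponentAnalysis

/-- Real tensors of order `d` and format `n × ⋯ × n`. -/
abbrev Tensor (n d : ℕ) : Type := (Fin d → Fin n) → ℝ

/-- The linear space `S^d(ℝⁿ)` of symmetric tensors. -/
def symSpace (n d : ℕ) : Submodule ℝ (Tensor n d) where
  carrier := {T | ∀ (σ : Equiv.Perm (Fin d)) (i : Fin d → Fin n), T (i ∘ σ) = T i}
  add_mem' := fun {a b} ha hb σ i => by simp only [Pi.add_apply, ha σ i, hb σ i]
  zero_mem' := fun _ _ => rfl
  smul_mem' := fun c a ha σ i => by simp only [Pi.smul_apply, ha σ i]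

/-- `V_diag`: the symmetric tensors with `T_{i₁…i_d} ≠ 0` only if `i₁ = ⋯ = i_d`. -/
def diagSpace (n d : ℕ) : Submodule ℝ (Tensor n d) where
  carrier := {T | T ∈ symSpace n d ∧ ∀ i : Fin d → Fin n, T i ≠ 0 → ∀ k l, i k = i l}
  add_mem' := fun {a b} ha hb => by
    refine ⟨add_mem ha.1 hb.1, fun i hi => ?_⟩
    by_cases h : a i = 0
    · refine hb.2 i fun h' => hi ?_
      simp [h, h']
    · exact ha.2 i h
  zero_mem' := ⟨zero_mem _, fun _ hi => (hi rfl).elim⟩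
  smul_mem' := fun c a ha => by
    refine ⟨Submodule.smul_mem _ c ha.1, fun i hi => ha.2 i fun h => hi ?_⟩
    simp [h]

/-- The multi-index `(i, j, …, j)` of length `d`. -/
def pmiIndex {n : ℕ} (d : ℕ) (i j : Fin n) : Fin d → Fin n :=
  fun k => if (k : ℕ) = 0 then i else j

/-- `V_pmi`: the symmetric tensors with `T_{ij…j} = 0` for all `i ≠ j`. -/
def pmiSpace (n d : ℕ) : Submodule ℝ (Tensor n d) where
  carrier := {T | T ∈ symSpace n d ∧ ∀ i j : Fin n, i ≠ j → T (pmiIndex d i j) = 0}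
  add_mem' := fun {a b} ha hb =>
    ⟨add_mem ha.1 hb.1, fun i j h => by simp [ha.2 i j h, hb.2 i j h]⟩
  zero_mem' := ⟨zero_mem _, fun _ _ _ => rfl⟩
  smul_mem' := fun c a ha =>
    ⟨Submodule.smul_mem _ c ha.1, fun i j h => by simp [ha.2 i j h]⟩

/-- A property of tensors holds for all sufficiently general elements of the linear space `V`: there
is a polynomial in the tensor entries, not vanishing identically on `V`, such that the property
holds at every `T ∈ V` at which the polynomial is nonzero. -/
def ForGeneric {n d : ℕ} (V : Submodule ℝ (Tensor n d)) (P : Tensor n d → Prop) : Prop :=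
  ∃ p : MvPolynomial (Fin d → Fin n) ℝ,
    (∃ T ∈ V, MvPolynomial.eval T p ≠ 0) ∧ ∀ T ∈ V, MvPolynomial.eval T p ≠ 0 → P T

section RandomVectors

variable {Ω : Type*} [MeasurableSpace Ω]

/-- The covariance matrix of a random vector. -/
noncomputable def covMatrix {n : ℕ} (μ : Measure Ω) (z : Ω → Fin n → ℝ) :
    Matrix (Fin n) (Fin n) ℝ :=
  Matrix.of fun i j => ProbabilityTheory.covariance (fun ω => z ω i) (fun ω => z ω j) μ

/-- The `d`-th cumulant tensor of a random vector with finite moments of order `d`: the entry at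
`(i₁, …, i_d)` is `∑_π (-1)^(|π|-1) (|π|-1)! ∏_{B ∈ π} E (∏_{k ∈ B} z_{i_k})`, where `π` runs over
the set partitions of `{1, …, d}`. -/
noncomputable def cumulant {n : ℕ} (d : ℕ) (μ : Measure Ω) (z : Ω → Fin n → ℝ) : Tensor n d :=
  fun i => ∑ π : Finpartition (Finset.univ : Finset (Fin d)),
    (-1 : ℝ) ^ (π.parts.card - 1) * ((π.parts.card - 1).factorial : ℝ) *
      ∏ B ∈ π.parts, ∫ ω, ∏ k ∈ B, z ω (i k) ∂μ

/-- The sources of the component analysis model given by `V`: random vectors with finite moments of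
order `d`, identity covariance matrix, and `d`-th cumulant tensor in `V`. -/
structure IsSource {n d : ℕ} (V : Submodule ℝ (Tensor n d)) (μ : Measure Ω)
    (s : Ω → Fin n → ℝ) : Prop where
  memLp : ∀ i, MemLp (fun ω => s ω i) d μ
  cov_eq_one : covMatrix μ s = 1
  cumulant_mem : cumulant d μ s ∈ V

end RandomVectors

/-- `B` is obtained from `A` by permuting columns and flipping signs of columns. -/
def EqUpToSignedPerm {n : ℕ} (A B : Matrix (Fin n) (Fin n) ℝ) : Prop :=
  ∃ (σ : Equiv.Perm (Fin n)) (ε : Fin n → ℝ),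
    (∀ j, ε j = 1 ∨ ε j = -1) ∧ ∀ i j, B i j = ε j * A i (σ j)

end ComponentAnalysis

/-! Equal covariances make `Q = A⁻¹ * B` orthogonal, and multilinearity of cumulants puts the tensor
obtained from `T = κ_d(s)` by applying `Qᵀ` in every mode into `V_pmi`. Vanishing of its entries
`(a, b, …, b)` says that `T(·, q, …, q)` is parallel to `q` for each column `q` of `Q`. So the
columns form an orthonormal basis of eigenvectors of `T`, and the claim is that for general `T` only
signed unit vectors do so.

Unit vectors are eigenvectors of every tensor in `V_pmi`, so they must be excluded by a closed
condition: `det (saturationMatrix T u j)` vanishes at each eigenvector `u` that is no multiple of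
`e_j`, but not at nonzero multiples of `e_j` when `T` is the base tensor. Together with
orthogonality this gives a homogeneous system in `Q`, and by elimination theory (`exists_eliminant`)
a single `T` with only the zero complex solution suffices.

Such a `T` is diagonal with entries `baseWeight`: its eigenvectors have entries of size proportional
to `2 ^ i` on their support, so orthogonal ones have disjoint supports, and `n` nonzero ones must be
multiples of unit vectors (`eq_zero_of_baseTensor`). Being diagonal, it lies in every admissible
`V`. -/

namespace ComponentAnalysis

/-! ### Elimination theory over `ℂ` and descent to real parameters -/

section Elimination

open MvPolynomial

variable {τ ι : Type*}

/-- A homogeneous system whose only common zero over an algebraically closed field is the origin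
generates an ideal containing all forms of some degree. -/
theorem exists_homogeneousSubmodule_subset_of_zeroLocus {K : Type*} [Field K] [IsAlgClosed K]
    [Finite ι] (J : Ideal (MvPolynomial ι K))
    (h : ∀ x : ι → K, (∀ f ∈ J, eval x f = 0) → x = 0) :
    ∃ N : ℕ, ∀ f : MvPolynomial ι K, f.IsHomogeneous N → f ∈ J := by
  have hrad : idealOfVars ι K ≤ J.radical := by
    rw [← vanishingIdeal_zeroLocus_eq_radical (K := K), idealOfVars, Ideal.span_le]
    rintro _ ⟨i, rfl⟩ x hx
    have : x = 0 := h x fun f hf => by simpa [aeval_eq_eval] using hx f hf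
    simp [this]
  obtain ⟨N, hN⟩ := J.exists_radical_pow_le_of_fg (IsNoetherian.noetherian _)
  refine ⟨N, fun f hf => hN (Ideal.pow_right_mono hrad N ?_)⟩
  rw [mem_pow_idealOfVars_iff']
  exact fun x hx => hf.coeff_eq_zero hx.ne

/-- A homogeneous polynomial with coefficients in an ideal is in the product of that ideal with
the module of forms. -/
theorem mem_smul_homogeneousSubmodule {R : Type*} [CommRing R] (I : Ideal R) (N : ℕ)
    {f : MvPolynomial ι R} (hf : f.IsHomogeneous N) (hI : ∀ m, coeff m f ∈ I) :
    f ∈ I • homogeneousSubmodule ι R N := by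
  rw [f.as_sum]
  refine Submodule.sum_mem _ fun m hm => ?_
  have : monomial m (coeff m f) = coeff m f • monomial m (1 : R) := by
    simp [smul_monomial]
  rw [this]
  refine Submodule.smul_mem_smul (hI m) ?_
  rw [mem_homogeneousSubmodule]
  refine isHomogeneous_monomial _ ?_
  by_contra hne
  exact (mem_support_iff.1 hm) (hf.coeff_eq_zero hne)

/-- The main theorem of elimination theory, in the form needed here: if a system of homogeneous
equations with polynomial parameters has only the trivial solution at the parameter `t₀`, then it
has only the trivial solution at all parameters where some polynomial, nonzero at `t₀`, does not
vanish. -/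
theorem exists_eliminant {K : Type*} [Field K] [IsAlgClosed K] [Finite ι]
    (F : Set (MvPolynomial ι (MvPolynomial τ K))) (hF : ∀ f ∈ F, ∃ k, f.IsHomogeneous k)
    (t₀ : τ → K)
    (h : ∀ x : ι → K, (∀ f ∈ F, eval x (map (eval t₀) f) = 0) → x = 0) :
    ∃ p : MvPolynomial τ K, eval t₀ p ≠ 0 ∧ ∀ (t : τ → K) (x : ι → K), eval t p ≠ 0 →
      (∀ f ∈ F, eval x (map (eval t) f) = 0) → x = 0 := by
  set J : Ideal (MvPolynomial ι (MvPolynomial τ K)) := Ideal.span F with hJ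
  have hsurj : Function.Surjective (map (σ := ι) (eval t₀)) :=
    map_surjective _ fun c => ⟨C c, by simp⟩
  obtain ⟨N, hN⟩ := exists_homogeneousSubmodule_subset_of_zeroLocus
    (J.map (map (σ := ι) (eval t₀))) fun x hx =>
      h x fun f hf => hx _ (Ideal.mem_map_of_mem _ (Ideal.subset_span hf))
  let _ := gradedAlgebra (σ := ι) (R := MvPolynomial τ K)
  have hJhom : J.IsHomogeneous (homogeneousSubmodule ι (MvPolynomial τ K)) :=
    Ideal.homogeneous_span _ _ fun f hf =>
      let ⟨k, hk⟩ := hF f hf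
      ⟨k, hk⟩
  set I : Ideal (MvPolynomial τ K) := RingHom.ker (eval t₀) with hI
  set H := homogeneousSubmodule ι (MvPolynomial τ K) N with hH
  set q := (J.restrictScalars (MvPolynomial τ K)).mkQ with hq
  -- Nakayama's hypothesis: at `t₀` every form of degree `N` lies in the specialized ideal. Lifting
  -- and taking the degree `N` component, a form agrees modulo `J` with one whose coefficients
  -- vanish at `t₀`.
  have hle : H.map q ≤ I • H.map q := by
    rw [← Submodule.map_smul'']
    rintro _ ⟨f, hf, rfl⟩
    have hf' : f.IsHomogeneous N := hf
    obtain ⟨g, hgJ, hg⟩ := (Ideal.mem_map_iff_of_surjective _ hsurj).1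
      (hN (map (eval t₀) f) (hf'.map _))
    have hgN : homogeneousComponent N g ∈ J := homogeneousComponent_mem_of_mem hJhom hgJ N
    refine ⟨f - homogeneousComponent N g, ?_, ?_⟩
    · refine mem_smul_homogeneousSubmodule _ _
        (hf'.sub (homogeneousComponent_isHomogeneous N g)) fun m => ?_
      rw [hI, RingHom.mem_ker, coeff_sub, coeff_homogeneousComponent]
      split_ifs with hm
      · have := congrArg (coeff m) hg
        rw [coeff_map, coeff_map] at this
        rw [map_sub, this, sub_self]
      · rw [hf'.coeff_eq_zero hm, sub_zero, map_zero]
    · rw [map_sub, sub_eq_self, hq, Submodule.mkQ_apply, Submodule.Quotient.mk_eq_zero]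
      exact hgN
  obtain ⟨r, hr, hr'⟩ := Submodule.exists_sub_one_mem_and_smul_eq_zero_of_fg_of_le_smul I
    (H.map q) ((homogeneousSubmodule_fg _ _ N).map q) hle
  have hr1 : eval t₀ r = 1 := by
    have : eval t₀ (r - 1) = 0 := hr
    simpa [sub_eq_zero] using this
  refine ⟨r, by simp [hr1], fun t x ht hx => ?_⟩
  funext i
  -- This membership holds before specialization, so at any `t` with `r(t) ≠ 0` it forces `x i ^ N =
  -- 0`.
  have hmem : r • (X i : MvPolynomial ι (MvPolynomial τ K)) ^ N ∈ J := by
    have := hr' (q (X i ^ N)) ⟨_, isHomogeneous_X_pow i N, rfl⟩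
    rwa [← map_smul, hq, Submodule.mkQ_apply, Submodule.Quotient.mk_eq_zero] at this
  have hker : J ≤ RingHom.ker ((eval x).comp (map (eval t))) :=
    Ideal.span_le.2 fun f hf => hx f hf
  have := hker hmem
  rw [RingHom.mem_ker, smul_eq_C_mul] at this
  simp only [RingHom.comp_apply, map_mul, map_C, eval_C, map_pow, map_X, eval_X] at this
  exact eq_zero_of_pow_eq_zero ((mul_eq_zero.1 this).resolve_left ht)

/-- The real part of a complex polynomial, as a function of real arguments, is a polynomial. -/
theorem exists_eval_eq_re (p : MvPolynomial τ ℂ) :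
    ∃ q : MvPolynomial τ ℝ, ∀ t : τ → ℝ, eval t q = (eval (fun i => (t i : ℂ)) p).re := by
  induction p using MvPolynomial.induction_on with
  | C a => exact ⟨C a.re, fun t => by simp⟩
  | add p₁ p₂ h₁ h₂ =>
    obtain ⟨q₁, h₁⟩ := h₁
    obtain ⟨q₂, h₂⟩ := h₂
    exact ⟨q₁ + q₂, fun t => by simp [h₁, h₂]⟩
  | mul_X p i h =>
    obtain ⟨q, h⟩ := h
    exact ⟨q * X i, fun t => by simp [h]⟩

/-- The real locus of the complement of a complex hypersurface contains a nonempty complement of a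
real hypersurface. -/
theorem exists_real_of_eval_ne_zero (p : MvPolynomial τ ℂ) (t₀ : τ → ℝ)
    (h : eval (fun i => (t₀ i : ℂ)) p ≠ 0) :
    ∃ q : MvPolynomial τ ℝ, eval t₀ q ≠ 0 ∧
      ∀ t : τ → ℝ, eval t q ≠ 0 → eval (fun i => (t i : ℂ)) p ≠ 0 := by
  -- Scaling makes the value at `t₀` equal to `1`, so its real part cannot vanish there.
  obtain ⟨q, hq⟩ := exists_eval_eq_re (C (eval (fun i => (t₀ i : ℂ)) p)⁻¹ * p)
  refine ⟨q, by simp [hq, h], fun t ht h0 => ht ?_⟩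
  simp [hq, h0]

end Elimination

/-! ### Multilinearity of cumulants and covariance -/

section Cumulants

variable {Ω : Type*} [MeasurableSpace Ω]

/-- The product of at most `d` functions in `L^d` of a probability space is integrable. -/
theorem integrable_prod_of_memLp {ι : Type*} {d : ℕ} (μ : Measure Ω)
    [IsProbabilityMeasure μ] (f : ι → Ω → ℝ) (s : Finset ι) (hs : s.card ≤ d)
    (hf : ∀ k ∈ s, MemLp (f k) d μ) : Integrable (fun ω => ∏ k ∈ s, f k ω) μ := by
  rw [← memLp_one_iff_integrable]
  -- Hölder gives the exponent `d / s.card ≥ 1`, which may be lowered to `1` on a probability space.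
  refine (MemLp.prod' hf).mono_exponent ?_
  rw [Finset.sum_const, nsmul_eq_mul, ENNReal.one_le_inv, ← div_eq_mul_inv]
  refine ENNReal.div_le_of_le_mul ?_
  rw [one_mul]
  exact_mod_cast hs

/-- The space of real functions with finite moments of order `p`. -/
def memLpSubmodule (p : ENNReal) (μ : Measure Ω) : Submodule ℝ (Ω → ℝ) where
  carrier := {f | MemLp f p μ}
  add_mem' := fun ha hb => MemLp.add ha hb
  zero_mem' := MemLp.zero
  smul_mem' := fun c _ ha => MemLp.const_smul ha c

/-- The index `k` lies in exactly one block, so slot `k` affects one factor only; linearity in each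
slot follows. -/
theorem prod_integral_update {d : ℕ} (μ : Measure Ω)
    (π : Finpartition (Finset.univ : Finset (Fin d))) (f : Fin d → Ω → ℝ) (k : Fin d)
    (x : Ω → ℝ) :
    ∏ B ∈ π.parts, ∫ ω, ∏ l ∈ B, Function.update f k x l ω ∂μ =
      (∫ ω, x ω * ∏ l ∈ (π.part k).erase k, f l ω ∂μ) *
        ∏ B ∈ π.parts.erase (π.part k), ∫ ω, ∏ l ∈ B, f l ω ∂μ := by
  have hk : k ∈ π.part k := π.mem_part_self.2 (Finset.mem_univ k)
  rw [← Finset.mul_prod_erase _ _ (π.part_mem.2 (Finset.mem_univ k))]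
  congr 1
  · congr 1
    funext ω
    rw [← Finset.mul_prod_erase _ _ hk, Function.update_self]
    congr 1
    refine Finset.prod_congr rfl fun l hl => ?_
    rw [Function.update_of_ne (Finset.ne_of_mem_erase hl)]
  · refine Finset.prod_congr rfl fun B hB => ?_
    congr 1
    funext ω
    refine Finset.prod_congr rfl fun l hl => ?_
    rw [Function.update_of_ne]
    rintro rfl
    exact Finset.ne_of_mem_erase hB (π.part_eq_of_mem (Finset.mem_of_mem_erase hB) hl).symm

/-- The product over the blocks of a set partition of the mixed moments, as a multilinear map. -/
noncomputable def momentMap {d : ℕ} (μ : Measure Ω) [IsProbabilityMeasure μ]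
    (π : Finpartition (Finset.univ : Finset (Fin d))) :
    MultilinearMap ℝ (fun _ : Fin d => memLpSubmodule (d : ENNReal) μ) ℝ where
  toFun f := ∏ B ∈ π.parts, ∫ ω, ∏ l ∈ B, (f l : Ω → ℝ) ω ∂μ
  map_update_add' := by
    intro inst f k x y
    obtain rfl : inst = instDecidableEqFin d := Subsingleton.elim _ _
    have hupd : ∀ z : memLpSubmodule (d : ENNReal) μ, ∀ l,
        ((Function.update f k z l : memLpSubmodule (d : ENNReal) μ) : Ω → ℝ) =
          Function.update (fun l => (f l : Ω → ℝ)) k (z : Ω → ℝ) l := fun z l => by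
      rcases eq_or_ne l k with rfl | h
      · simp
      · simp [h]
    have hint : ∀ z : memLpSubmodule (d : ENNReal) μ,
        Integrable (fun ω => (z : Ω → ℝ) ω * ∏ l ∈ (π.part k).erase k, (f l : Ω → ℝ) ω) μ := by
      intro z
      have hk : k ∈ π.part k := π.mem_part_self.2 (Finset.mem_univ k)
      have := integrable_prod_of_memLp (d := d) μ
        (fun l => (Function.update f k z l : Ω → ℝ)) (π.part k)
        ((Finset.card_le_univ _).trans_eq (Fintype.card_fin d))
        fun l _ => (Function.update f k z l).2
      refine this.congr (Filter.Eventually.of_forall fun ω => ?_)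
      simp only
      rw [← Finset.mul_prod_erase _ _ hk, Function.update_self]
      congr 1
      refine Finset.prod_congr rfl fun l hl => ?_
      rw [Function.update_of_ne (Finset.ne_of_mem_erase hl)]
    simp only [hupd]
    rw [prod_integral_update, prod_integral_update, prod_integral_update, ← add_mul,
      ← integral_add (hint x) (hint y)]
    simp [add_mul]
  map_update_smul' := by
    intro inst f k c x
    obtain rfl : inst = instDecidableEqFin d := Subsingleton.elim _ _
    have hupd : ∀ z : memLpSubmodule (d : ENNReal) μ, ∀ l,
        ((Function.update f k z l : memLpSubmodule (d : ENNReal) μ) : Ω → ℝ) =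
          Function.update (fun l => (f l : Ω → ℝ)) k (z : Ω → ℝ) l := fun z l => by
      rcases eq_or_ne l k with rfl | h
      · simp
      · simp [h]
    simp only [hupd]
    rw [prod_integral_update, prod_integral_update, smul_eq_mul, ← mul_assoc,
      ← integral_const_mul]
    simp [mul_assoc]

/-- The joint cumulant of `d` random variables with finite moments of order `d`. -/
noncomputable def cumulantMap {d : ℕ} (μ : Measure Ω) [IsProbabilityMeasure μ] :
    MultilinearMap ℝ (fun _ : Fin d => memLpSubmodule (d : ENNReal) μ) ℝ :=
  ∑ π : Finpartition (Finset.univ : Finset (Fin d)),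
    ((-1 : ℝ) ^ (π.parts.card - 1) * ((π.parts.card - 1).factorial : ℝ)) • momentMap μ π

theorem cumulant_eq_cumulantMap {n d : ℕ} (μ : Measure Ω) [IsProbabilityMeasure μ]
    (z : Ω → Fin n → ℝ) (hz : ∀ i, MemLp (fun ω => z ω i) d μ) (i : Fin d → Fin n) :
    cumulant d μ z i = cumulantMap μ fun k => ⟨fun ω => z ω (i k), hz (i k)⟩ := by
  simp [cumulant, cumulantMap, momentMap]

/-- Multiplication of a tensor by a matrix along every mode. -/
def tensorAct {n d : ℕ} (M : Matrix (Fin n) (Fin n) ℝ) (T : Tensor n d) : Tensor n d :=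
  fun i => ∑ j : Fin d → Fin n, (∏ k, M (i k) (j k)) * T j

theorem memLp_mulVec {n d : ℕ} (μ : Measure Ω) (M : Matrix (Fin n) (Fin n) ℝ)
    (z : Ω → Fin n → ℝ) (hz : ∀ i, MemLp (fun ω => z ω i) d μ) (i : Fin n) :
    MemLp (fun ω => M.mulVec (z ω) i) d μ :=
  memLp_finsetSum Finset.univ fun j _ => (hz j).const_mul (M i j)

/-- Cumulant tensors are multilinear. -/
theorem cumulant_mulVec {n d : ℕ} (μ : Measure Ω) [IsProbabilityMeasure μ]
    (M : Matrix (Fin n) (Fin n) ℝ) (z : Ω → Fin n → ℝ)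
    (hz : ∀ i, MemLp (fun ω => z ω i) d μ) :
    cumulant d μ (fun ω => M.mulVec (z ω)) = tensorAct M (cumulant d μ z) := by
  funext i
  rw [cumulant_eq_cumulantMap μ _ (memLp_mulVec μ M z hz)]
  have : (fun k => (⟨fun ω => M.mulVec (z ω) (i k), memLp_mulVec μ M z hz (i k)⟩ :
      memLpSubmodule (d : ENNReal) μ)) =
      fun k => ∑ j, M (i k) j • (⟨fun ω => z ω j, hz j⟩ : memLpSubmodule (d : ENNReal) μ) := by
    funext k
    ext ω
    simp [Matrix.mulVec, dotProduct, Finset.sum_apply]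
  rw [this, MultilinearMap.map_sum]
  refine Finset.sum_congr rfl fun j _ => ?_
  rw [MultilinearMap.map_smul_univ, cumulant_eq_cumulantMap μ z hz, smul_eq_mul]

theorem tensorAct_tensorAct {n d : ℕ} (M N : Matrix (Fin n) (Fin n) ℝ) (T : Tensor n d) :
    tensorAct M (tensorAct N T) = tensorAct (M * N) T := by
  funext i
  simp only [tensorAct, Matrix.mul_apply, Finset.mul_sum]
  rw [Finset.sum_comm]
  refine Finset.sum_congr rfl fun j _ => ?_
  rw [Finset.prod_univ_sum, Finset.sum_mul, Fintype.piFinset_univ]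
  refine Finset.sum_congr rfl fun l _ => ?_
  rw [Finset.prod_mul_distrib, mul_assoc]

theorem tensorAct_one {n d : ℕ} (T : Tensor n d) : tensorAct 1 T = T := by
  funext i
  rw [tensorAct, Finset.sum_eq_single i]
  · simp
  · intro j _ hj
    obtain ⟨k, hk⟩ := Function.ne_iff.1 hj
    have : (1 : Matrix (Fin n) (Fin n) ℝ) (i k) (j k) = 0 := Matrix.one_apply_ne hk.symm
    exact mul_eq_zero_of_left (Finset.prod_eq_zero (Finset.mem_univ k) this) _
  · simp

theorem covMatrix_mulVec {n : ℕ} (μ : Measure Ω) [IsProbabilityMeasure μ]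
    (M : Matrix (Fin n) (Fin n) ℝ) (z : Ω → Fin n → ℝ)
    (hz : ∀ i, MemLp (fun ω => z ω i) 2 μ) :
    covMatrix μ (fun ω => M.mulVec (z ω)) = M * covMatrix μ z * M.transpose := by
  ext i j
  simp only [covMatrix, Matrix.of_apply, Matrix.mulVec, dotProduct, Matrix.mul_apply,
    Matrix.transpose_apply]
  rw [ProbabilityTheory.covariance_fun_sum_fun_sum (fun k => (hz k).const_mul (M i k))
    (fun k => (hz k).const_mul (M j k)), Finset.sum_comm]
  refine Finset.sum_congr rfl fun l _ => ?_
  rw [Finset.sum_mul]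
  refine Finset.sum_congr rfl fun k _ => ?_
  rw [ProbabilityTheory.covariance_const_mul_left, ProbabilityTheory.covariance_const_mul_right]
  ring

end Cumulants

/-! ### Eigenvectors of tensors and the saturation determinant -/

section Contraction

variable {n e : ℕ} {R S : Type*} [CommRing R] [CommRing S]

/-- The vector `T(·, u, …, u)`. -/
def contr (T : (Fin (e + 2) → Fin n) → R) (u : Fin n → R) (k : Fin n) : R :=
  ∑ i : Fin (e + 1) → Fin n, T (Fin.cons k i) * ∏ m, u (i m)

/-- A position where the multi-index `i` differs from `j`, if there is one. -/
noncomputable def pick (j : Fin n) (i : Fin (e + 1) → Fin n) : Fin (e + 1) :=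
  -- The value `0` is junk; `linCoeff` discards the constant multi-index.
  open Classical in if h : ∃ m, i m ≠ j then h.choose else 0

theorem pick_spec {j : Fin n} {i : Fin (e + 1) → Fin n} (h : ∃ m, i m ≠ j) :
    i (pick j i) ≠ j := by
  rw [pick, dif_pos h]
  exact h.choose_spec

/-- The coefficient of `u l` when `T(e_k, u, …, u)`, without its `u j ^ (e + 1)` term, is written as
a linear combination of the `u l` for `l ≠ j`. -/
noncomputable def linCoeff (T : (Fin (e + 2) → Fin n) → R) (u : Fin n → R) (j k l : Fin n) : R :=
  open Classical in ∑ i : Fin (e + 1) → Fin n,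
    if (∃ m, i m ≠ j) ∧ i (pick j i) = l then
      T (Fin.cons k i) * ∏ m ∈ Finset.univ.erase (pick j i), u (i m) else 0

/-- The vector `u` with its `j`-th entry replaced by `0`. -/
def offPart (u : Fin n → R) (j l : Fin n) : R := if l = j then 0 else u l

/-- Every monomial other than `u j ^ (e + 1)` contains some `u l` with `l ≠ j`; `pick` chooses which
one to split off. -/
theorem contr_eq_add_sum (T : (Fin (e + 2) → Fin n) → R) (u : Fin n → R) (j k : Fin n) :
    contr T u k = T (Fin.cons k fun _ => j) * u j ^ (e + 1) +
      ∑ l, linCoeff T u j k l * offPart u j l := by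
  classical
  have h1 : T (Fin.cons k fun _ => j) * u j ^ (e + 1) =
      ∑ i : Fin (e + 1) → Fin n,
        if i = (fun _ => j) then T (Fin.cons k i) * ∏ m, u (i m) else 0 := by
    rw [Finset.sum_ite_eq' Finset.univ (fun _ => j)]
    simp
  have h2 : ∑ l, linCoeff T u j k l * offPart u j l =
      ∑ i : Fin (e + 1) → Fin n,
        if i = (fun _ => j) then 0 else T (Fin.cons k i) * ∏ m, u (i m) := by
    simp only [linCoeff, Finset.sum_mul]
    rw [Finset.sum_comm]
    refine Finset.sum_congr rfl fun i _ => ?_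
    split_ifs with h
    · refine Finset.sum_eq_zero fun l _ => ?_
      rw [if_neg, zero_mul]
      rintro ⟨⟨m, hm⟩, -⟩
      exact hm (congrFun h m)
    · have h' : ∃ m, i m ≠ j := Function.ne_iff.1 h
      rw [Finset.sum_eq_single (i (pick j i))]
      · rw [if_pos ⟨h', rfl⟩, offPart, if_neg (pick_spec h'), mul_assoc,
          Finset.prod_erase_mul _ _ (Finset.mem_univ _)]
      · intro l _ hl
        rw [if_neg fun h => hl h.2.symm, zero_mul]
      · simp
  rw [h1, h2, ← Finset.sum_add_distrib, contr]
  refine Finset.sum_congr rfl fun i _ => ?_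
  split_ifs <;> simp

/-- A matrix that annihilates `offPart u j` if `u` is an eigenvector of a pairwise mean independent
tensor `T`. Its determinant does not vanish at multiples of the `j`-th unit vector if `T` is a
general diagonal tensor. -/
noncomputable def saturationMatrix (T : (Fin (e + 2) → Fin n) → R) (u : Fin n → R) (j : Fin n) :
    Matrix (Fin n) (Fin n) R :=
  -- Row `j` annihilates `offPart u j` trivially; the power `e + 1` gives it the same degree as the
  -- other rows.
  Matrix.of fun k l => if k = j then (if l = j then u j ^ (e + 1) else 0) else
    u j * linCoeff T u j k l - if k = l then contr T u j else 0

theorem saturationMatrix_mulVec (T : (Fin (e + 2) → Fin n) → R) (u : Fin n → R) (j : Fin n)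
    (hT : ∀ k, k ≠ j → T (Fin.cons k fun _ => j) = 0)
    (hu : ∀ k l, u k * contr T u l = u l * contr T u k) :
    (saturationMatrix T u j).mulVec (offPart u j) = 0 := by
  funext k
  simp only [saturationMatrix, Matrix.mulVec, dotProduct, Matrix.of_apply, Pi.zero_apply]
  by_cases hk : k = j
  · refine Finset.sum_eq_zero fun l _ => ?_
    rw [if_pos hk, offPart]
    split_ifs <;> simp
  · have h := contr_eq_add_sum T u j k
    rw [hT k hk, zero_mul, zero_add] at h
    simp only [if_neg hk, sub_mul, Finset.sum_sub_distrib, mul_assoc, ← Finset.mul_sum, ite_mul,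
      zero_mul, Finset.sum_ite_eq, Finset.mem_univ, if_true]
    -- Row `k` of the product is `u j * contr T u k - u k * contr T u j`, zero by the eigenvector
    -- equations.
    rw [← h, hu, offPart, if_neg hk, mul_comm, sub_self]

theorem det_saturationMatrix_eq_zero [IsDomain R] (T : (Fin (e + 2) → Fin n) → R) (u : Fin n → R)
    (j : Fin n) (hT : ∀ k, k ≠ j → T (Fin.cons k fun _ => j) = 0)
    (hu : ∀ k l, u k * contr T u l = u l * contr T u k) (h : ∃ l, l ≠ j ∧ u l ≠ 0) :
    (saturationMatrix T u j).det = 0 := by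
  refine Matrix.exists_mulVec_eq_zero_iff.1
    ⟨offPart u j, fun h0 => ?_, saturationMatrix_mulVec T u j hT hu⟩
  obtain ⟨l, hl, hul⟩ := h
  have := congrFun h0 l
  rw [offPart, if_neg hl] at this
  exact hul this

theorem map_contr (φ : R →+* S) (T : (Fin (e + 2) → Fin n) → R) (u : Fin n → R) (k : Fin n) :
    φ (contr T u k) = contr (fun i => φ (T i)) (fun i => φ (u i)) k := by
  simp [contr, map_sum, map_prod]

theorem map_linCoeff (φ : R →+* S) (T : (Fin (e + 2) → Fin n) → R) (u : Fin n → R)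
    (j k l : Fin n) :
    φ (linCoeff T u j k l) = linCoeff (fun i => φ (T i)) (fun i => φ (u i)) j k l := by
  simp [linCoeff, map_sum, map_prod, apply_ite φ]

theorem map_det_saturationMatrix (φ : R →+* S) (T : (Fin (e + 2) → Fin n) → R) (u : Fin n → R)
    (j : Fin n) :
    φ (saturationMatrix T u j).det =
      (saturationMatrix (fun i => φ (T i)) (fun i => φ (u i)) j).det := by
  rw [RingHom.map_det]
  congr 1
  ext k l
  simp [saturationMatrix, apply_ite φ, map_contr, map_linCoeff]

section Homogeneous

open MvPolynomial

variable {ι : Type*} (T : (Fin (e + 2) → Fin n) → R) (v : Fin n → ι)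

theorem isHomogeneous_contr (k : Fin n) :
    (contr (fun i => (C (T i) : MvPolynomial ι R)) (fun i => X (v i)) k).IsHomogeneous (e + 1) := by
  refine IsHomogeneous.sum _ _ _ fun i _ => ?_
  have := (isHomogeneous_C ι (T (Fin.cons k i))).mul
    (IsHomogeneous.prod Finset.univ (fun m : Fin (e + 1) => (X (v (i m)) : MvPolynomial ι R))
      (fun _ => 1) fun m _ => isHomogeneous_X _ _)
  simpa using this

theorem isHomogeneous_linCoeff (j k l : Fin n) :
    (linCoeff (fun i => (C (T i) : MvPolynomial ι R)) (fun i => X (v i)) j k l).IsHomogeneous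
      e := by
  refine IsHomogeneous.sum _ _ _ fun i _ => ?_
  split_ifs
  · have := (isHomogeneous_C ι (T (Fin.cons k i))).mul
      (IsHomogeneous.prod (Finset.univ.erase (pick j i))
        (fun m : Fin (e + 1) => (X (v (i m)) : MvPolynomial ι R))
        (fun _ => 1) fun m _ => isHomogeneous_X _ _)
    simpa using this
  · exact isHomogeneous_zero _ _ _

theorem isHomogeneous_det_saturationMatrix (j : Fin n) :
    (saturationMatrix (fun i => (C (T i) : MvPolynomial ι R)) (fun i => X (v i)) j).det.IsHomogeneous
      (n * (e + 1)) := by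
  rw [Matrix.det_apply]
  refine IsHomogeneous.sum _ _ _ fun σ _ => ?_
  have hentry : ∀ k l, (saturationMatrix (fun i => (C (T i) : MvPolynomial ι R))
      (fun i => X (v i)) j k l).IsHomogeneous (e + 1) := by
    intro k l
    simp only [saturationMatrix, Matrix.of_apply]
    split_ifs
    · exact isHomogeneous_X_pow _ _
    · exact isHomogeneous_zero _ _ _
    · refine IsHomogeneous.sub ?_ (isHomogeneous_contr T v j)
      simpa [add_comm] using (isHomogeneous_X R (v j)).mul (isHomogeneous_linCoeff T v j k l)
    · rw [sub_zero]
      simpa [add_comm] using (isHomogeneous_X R (v j)).mul (isHomogeneous_linCoeff T v j k l)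
  have hprod := IsHomogeneous.prod Finset.univ
    (fun k => saturationMatrix (fun i => (C (T i) : MvPolynomial ι R)) (fun i => X (v i)) j (σ k) k)
    (fun _ => e + 1) fun k _ => hentry _ _
  rw [Finset.sum_const, Finset.card_univ, Fintype.card_fin, smul_eq_mul] at hprod
  rcases Int.units_eq_one_or (Equiv.Perm.sign σ) with h | h <;> rw [h]
  · simpa using hprod
  · simpa using hprod.neg

end Homogeneous

end Contraction

/-! ### The base tensor and its eigenvectors -/

section Diagonal

variable {n e : ℕ} {R : Type*} [CommRing R]

/-- The diagonal tensor with diagonal entries `w`. -/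
def diagTensor (w : Fin n → R) (i : Fin (e + 2) → Fin n) : R :=
  if ∀ m, i m = i 0 then w (i 0) else 0

theorem diagTensor_cons_eq_zero (w : Fin n → R) {k : Fin n} {i : Fin (e + 1) → Fin n}
    {m : Fin (e + 1)} (h : i m ≠ k) :
    diagTensor w (Fin.cons k i : Fin (e + 2) → Fin n) = 0 := by
  rw [diagTensor, if_neg]
  intro h'
  exact h (by simpa using h' m.succ)

theorem contr_diagTensor (w u : Fin n → R) (k : Fin n) :
    contr (diagTensor w : (Fin (e + 2) → Fin n) → R) u k = w k * u k ^ (e + 1) := by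
  rw [contr, Finset.sum_eq_single fun _ => k]
  · have : ∀ m : Fin (e + 2), (Fin.cons k fun _ => k : Fin (e + 2) → Fin n) m = k := fun m => by
      refine Fin.cases ?_ (fun m => ?_) m <;> simp
    simp [diagTensor, this]
  · intro i _ hi
    obtain ⟨m, hm⟩ := Function.ne_iff.1 hi
    rw [diagTensor_cons_eq_zero w hm, zero_mul]
  · simp

/-- Only `i = (k, …, k)` could contribute. As `e ≥ 1`, a factor `u k = 0` survives the removal of
one position. -/
theorem linCoeff_diagTensor (he : e ≠ 0) (w u : Fin n → R) {j k : Fin n} (hk : k ≠ j)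
    (hu : ∀ l, l ≠ j → u l = 0) (l : Fin n) :
    linCoeff (diagTensor w : (Fin (e + 2) → Fin n) → R) u j k l = 0 := by
  refine Finset.sum_eq_zero fun i _ => ?_
  split_ifs
  · by_cases hi : ∀ m, i m = k
    · have : Nontrivial (Fin (e + 1)) := Fin.nontrivial_iff_two_le.2 (by omega)
      obtain ⟨m, hm⟩ := exists_ne (pick j i)
      rw [Finset.prod_eq_zero (Finset.mem_erase.2 ⟨hm, Finset.mem_univ m⟩) (by rw [hi, hu k hk]),
        mul_zero]
    · push Not at hi
      obtain ⟨m, hm⟩ := hi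
      rw [diagTensor_cons_eq_zero w hm, zero_mul]
  · rfl

theorem det_saturationMatrix_diagTensor_ne_zero [IsDomain R] (he : e ≠ 0) (w u : Fin n → R)
    (hw : ∀ k, w k ≠ 0) {j : Fin n} (huj : u j ≠ 0) (hu : ∀ l, l ≠ j → u l = 0) :
    (saturationMatrix (diagTensor w : (Fin (e + 2) → Fin n) → R) u j).det ≠ 0 := by
  have : saturationMatrix (diagTensor w : (Fin (e + 2) → Fin n) → R) u j =
      Matrix.diagonal fun k => if k = j then u j ^ (e + 1) else -(w j * u j ^ (e + 1)) := by
    ext k l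
    simp only [saturationMatrix, Matrix.of_apply, Matrix.diagonal_apply]
    by_cases hk : k = j
    · simp [hk, eq_comm]
    · rw [if_neg hk, if_neg hk, linCoeff_diagTensor he w u hk hu, contr_diagTensor]
      split_ifs <;> simp
  rw [this, Matrix.det_diagonal, Finset.prod_ne_zero_iff]
  intro k _
  split_ifs
  · exact pow_ne_zero _ huj
  · exact neg_ne_zero.2 (mul_ne_zero (hw j) (pow_ne_zero _ huj))

/-- The diagonal entries of a diagonal tensor whose eigenvectors are explicitly known to be in
general position. -/
noncomputable def baseWeight (e : ℕ) (i : Fin n) : ℝ := (1 / 2) ^ ((i : ℕ) * e)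

theorem baseWeight_ne_zero (e : ℕ) (i : Fin n) : baseWeight e i ≠ 0 := by
  unfold baseWeight
  positivity

/-- A sum of complex numbers whose nonzero terms have absolute values proportional to `4 ^ i` does
not vanish. -/
theorem sum_ne_zero_of_norm_eq (a : Fin n → ℂ) (c : ℝ) (hc : 0 < c)
    (ha : ∀ i, a i ≠ 0 → ‖a i‖ = c * 4 ^ (i : ℕ)) (h : ∃ i, a i ≠ 0) : ∑ i, a i ≠ 0 := by
  intro hsum
  obtain ⟨i₀, hi₀, hmax⟩ := (Finset.univ.filter fun i => a i ≠ 0).exists_maximal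
    (by simpa [Finset.Nonempty] using h)
  replace hi₀ : a i₀ ≠ 0 := by simpa using hi₀
  have hgt : ∀ i, i₀ < i → a i = 0 := fun i hi => by
    by_contra hne
    exact absurd (hmax (by simpa using hne) hi.le) (not_le.2 hi)
  have hsplit : a i₀ = -∑ i ∈ Finset.Iio i₀, a i := by
    have : ∑ i, a i = ∑ i ∈ Finset.Iic i₀, a i := by
      symm
      refine Finset.sum_subset (Finset.subset_univ _) fun i _ hi => hgt i ?_
      simpa using hi
    rw [hsum, ← Finset.Iio_insert, Finset.sum_insert (by simp)] at this
    exact eq_neg_of_add_eq_zero_left this.symm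
  have hle : ‖a i₀‖ ≤ c * ∑ i ∈ Finset.range i₀, (4 : ℝ) ^ i := by
    rw [hsplit, norm_neg, Finset.mul_sum, ← Nat.Iio_eq_range, ← Fin.map_valEmbedding_Iio,
      Finset.sum_map]
    refine norm_sum_le_of_le _ fun i _ => ?_
    by_cases hi : a i = 0
    · rw [hi, norm_zero]
      positivity
    · exact (ha i hi).le
  rw [ha i₀ hi₀] at hle
  -- The terms below the top one add up to at most `c * (4 ^ i₀ - 1) / 3`, too little to cancel it.
  have hgeom := geom_sum_mul (4 : ℝ) (i₀ : ℕ)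
  have h4 : (0 : ℝ) < 4 ^ (i₀ : ℕ) := by positivity
  have := le_of_mul_le_mul_left hle hc
  linarith

/-- Orthogonal complex eigenvectors of the base tensor have disjoint supports. -/
theorem mul_eq_zero_of_orthogonal (he : e ≠ 0) (u v : Fin n → ℂ)
    (hu : ∀ k l, u k * (baseWeight e l * u l ^ (e + 1)) = u l * (baseWeight e k * u k ^ (e + 1)))
    (hv : ∀ k l, v k * (baseWeight e l * v l ^ (e + 1)) = v l * (baseWeight e k * v k ^ (e + 1)))
    (huv : ∑ i, u i * v i = 0) (i : Fin n) : u i * v i = 0 := by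
  by_contra hi
  have key : ∀ z : Fin n → ℂ, (∀ k l, z k * (baseWeight e l * z l ^ (e + 1)) =
      z l * (baseWeight e k * z k ^ (e + 1))) → ∀ k, z k ≠ 0 → z i ≠ 0 →
      ‖z k‖ / 2 ^ (k : ℕ) = ‖z i‖ / 2 ^ (i : ℕ) := by
    intro z hz k hk hzi
    have h1 : (baseWeight e k : ℂ) * z k ^ e = baseWeight e i * z i ^ e := by
      have := hz i k
      rw [pow_succ, pow_succ] at this
      have h2 : (z i * z k) * ((baseWeight e k : ℂ) * z k ^ e) =
          (z i * z k) * (baseWeight e i * z i ^ e) := by linear_combination this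
      exact mul_left_cancel₀ (mul_ne_zero hzi hk) h2
    -- The weights are chosen for this identity: `‖z l‖ / 2 ^ l` is constant on the support.
    have h3 : ∀ l, ‖(baseWeight e l : ℂ) * z l ^ e‖ = (‖z l‖ / 2 ^ (l : ℕ)) ^ e := fun l => by
      rw [norm_mul, norm_pow, Complex.norm_real, Real.norm_eq_abs, baseWeight,
        abs_of_pos (by positivity), pow_mul, ← mul_pow]
      congr 1
      rw [one_div, inv_pow, mul_comm, div_eq_mul_inv]
    have h4 := congrArg norm h1
    rw [h3, h3] at h4
    exact (pow_left_inj₀ (by positivity) (by positivity) he).1 h4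
  have hui : u i ≠ 0 := left_ne_zero_of_mul hi
  have hvi : v i ≠ 0 := right_ne_zero_of_mul hi
  refine sum_ne_zero_of_norm_eq (fun k => u k * v k)
    ((‖u i‖ / 2 ^ (i : ℕ)) * (‖v i‖ / 2 ^ (i : ℕ))) ?_ (fun k hk => ?_) ⟨i, hi⟩ huv
  · have := norm_pos_iff.2 hui
    have := norm_pos_iff.2 hvi
    positivity
  · rw [← key u hu k (left_ne_zero_of_mul hk) hui, ← key v hv k (right_ne_zero_of_mul hk) hvi,
      norm_mul]
    have : (4 : ℝ) ^ (k : ℕ) = 2 ^ (k : ℕ) * 2 ^ (k : ℕ) := by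
      rw [← mul_pow]
      norm_num
    rw [this]
    field_simp

/-- The complex diagonal tensor with diagonal entries `baseWeight e`. -/
noncomputable def baseTensor (n e : ℕ) : (Fin (e + 2) → Fin n) → ℂ :=
  diagTensor fun i => (baseWeight e i : ℂ)

/-- At the base tensor, the system that describes nontrivial orthonormal bases of eigenvectors has
only the zero solution. -/
theorem eq_zero_of_baseTensor (he : e ≠ 0) (Q : Fin n × Fin n → ℂ) (a : Fin n)
    (heig : ∀ b k l, Q (k, b) * contr (baseTensor n e) (fun i => Q (i, b)) l =
      Q (l, b) * contr (baseTensor n e) (fun i => Q (i, b)) k)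
    (horth : ∀ b c, b ≠ c → ∑ i, Q (i, b) * Q (i, c) = 0)
    (hnorm : ∀ b c, ∑ i, Q (i, b) * Q (i, b) = ∑ i, Q (i, c) * Q (i, c))
    (hdet : ∀ j, (saturationMatrix (baseTensor n e) (fun i => Q (i, a)) j).det = 0) : Q = 0 := by
  simp only [baseTensor, contr_diagTensor] at heig
  have hdisj : ∀ b c, ∑ i, Q (i, b) * Q (i, c) = 0 → ∀ i, Q (i, b) * Q (i, c) = 0 :=
    fun b c h => mul_eq_zero_of_orthogonal he _ _ (heig b) (heig c) h
  -- Complex columns may be isotropic. By equal lengths all are then, and each, being orthogonal to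
  -- itself, is zero.
  by_cases h0 : ∑ i, Q (i, a) * Q (i, a) = 0
  · funext ⟨i, b⟩
    exact mul_self_eq_zero.1 (hdisj b b ((hnorm b a).trans h0) i)
  · exfalso
    have hex : ∀ b, ∃ i, Q (i, b) ≠ 0 := fun b => by
      by_contra! hb
      exact h0 ((hnorm a b).trans (by simp [hb]))
    choose f hf using hex
    have hinj : Function.Injective f := fun b c hbc => by
      by_contra hne
      have := hdisj b c (horth b c hne) (f b)
      rcases mul_eq_zero.1 this with h | h
      · exact hf b h
      · exact hf c (hbc ▸ h)
    refine det_saturationMatrix_diagTensor_ne_zero he _ _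
      (fun k => Complex.ofReal_ne_zero.2 (baseWeight_ne_zero e k)) (hf a) (fun l hl => ?_)
      (hdet (f a))
    -- Every coordinate but `f a` is in the support of another column, so column `a` vanishes there.
    obtain ⟨b, rfl⟩ := Finite.surjective_of_injective hinj l
    have hab : b ≠ a := fun h => hl (h ▸ rfl)
    exact (mul_eq_zero.1 (hdisj b a (horth b a hab) (f b))).resolve_left (hf b)

end Diagonal

/-! ### Eigenbases of general tensors -/

section Generic

open MvPolynomial

/-- The system of equations, in an unknown matrix `Q` and an unknown tensor, which says that the
columns of `Q` are pairwise orthogonal eigenvectors of the same length and that column `a`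
satisfies the closed conditions that hold for eigenvectors that are no multiples of unit
vectors. -/
def eigenbasisSystem (n e : ℕ) (a : Fin n) :
    Set (MvPolynomial (Fin n × Fin n) (MvPolynomial (Fin (e + 2) → Fin n) ℂ)) :=
  let T : (Fin (e + 2) → Fin n) →
    MvPolynomial (Fin n × Fin n) (MvPolynomial (Fin (e + 2) → Fin n) ℂ) := fun i => C (X i)
  {f | ∃ b k l, f = X (k, b) * contr T (fun i => X (i, b)) l -
      X (l, b) * contr T (fun i => X (i, b)) k} ∪
  {f | ∃ b c, b ≠ c ∧ f = ∑ i, X (i, b) * X (i, c)} ∪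
  -- Equal lengths replace unit lengths to keep the system homogeneous.
  {f | ∃ b c, f = ∑ i, X (i, b) * X (i, b) - ∑ i, X (i, c) * X (i, c)} ∪
  {f | ∃ j, f = (saturationMatrix T (fun i => X (i, a)) j).det}

theorem isHomogeneous_of_mem_eigenbasisSystem {n e : ℕ} {a : Fin n}
    {f : MvPolynomial (Fin n × Fin n) (MvPolynomial (Fin (e + 2) → Fin n) ℂ)}
    (hf : f ∈ eigenbasisSystem n e a) : ∃ k, f.IsHomogeneous k := by
  have hXX : ∀ b c : Fin n, (∑ i, X (i, b) * X (i, c) : MvPolynomial (Fin n × Fin n)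
      (MvPolynomial (Fin (e + 2) → Fin n) ℂ)).IsHomogeneous 2 := fun b c =>
    IsHomogeneous.sum _ _ _ fun i _ => (isHomogeneous_X _ _).mul (isHomogeneous_X _ _)
  rcases hf with ((⟨b, k, l, rfl⟩ | ⟨b, c, -, rfl⟩) | ⟨b, c, rfl⟩) | ⟨j, rfl⟩
  · exact ⟨_, ((isHomogeneous_X _ _).mul (isHomogeneous_contr X (fun i => (i, b)) l)).sub
      ((isHomogeneous_X _ _).mul (isHomogeneous_contr X (fun i => (i, b)) k))⟩
  · exact ⟨_, hXX b c⟩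
  · exact ⟨_, (hXX b b).sub (hXX c c)⟩
  · exact ⟨_, isHomogeneous_det_saturationMatrix X (fun i => (i, a)) j⟩

theorem eval_eigenbasisSystem_eq_zero_iff {n e : ℕ} (a : Fin n)
    (T : (Fin (e + 2) → Fin n) → ℂ) (Q : Fin n × Fin n → ℂ) :
    (∀ f ∈ eigenbasisSystem n e a, eval Q (map (eval T) f) = 0) ↔
      (∀ b k l, Q (k, b) * contr T (fun i => Q (i, b)) l =
        Q (l, b) * contr T (fun i => Q (i, b)) k) ∧
      (∀ b c, b ≠ c → ∑ i, Q (i, b) * Q (i, c) = 0) ∧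
      (∀ b c, ∑ i, Q (i, b) * Q (i, b) = ∑ i, Q (i, c) * Q (i, c)) ∧
      ∀ j, (saturationMatrix T (fun i => Q (i, a)) j).det = 0 := by
  have hcontr : ∀ b k, eval Q (map (eval T) (contr (fun i => (C (X i) :
      MvPolynomial (Fin n × Fin n)
      (MvPolynomial (Fin (e + 2) → Fin n) ℂ))) (fun i => X (i, b)) k)) =
      contr T (fun i => Q (i, b)) k := fun b k => by
    have := map_contr ((eval Q).comp (map (eval T)))
      (fun i : Fin (e + 2) → Fin n => C (X i)) (fun i => X (i, b)) k
    simpa using this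
  have hdet : ∀ j, eval Q (map (eval T) (saturationMatrix (fun i => (C (X i) :
      MvPolynomial (Fin n × Fin n)
      (MvPolynomial (Fin (e + 2) → Fin n) ℂ)))
      (fun i => X (i, a)) j).det) = (saturationMatrix T (fun i => Q (i, a)) j).det := fun j => by
    have := map_det_saturationMatrix ((eval Q).comp (map (eval T)))
      (fun i : Fin (e + 2) → Fin n => C (X i)) (fun i => X (i, a)) j
    simpa using this
  constructor
  · intro h
    refine ⟨fun b k l => ?_, fun b c hbc => ?_, fun b c => ?_, fun j => ?_⟩
    · have := h _ (Or.inl (Or.inl (Or.inl ⟨b, k, l, rfl⟩)))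
      simpa [hcontr, sub_eq_zero] using this
    · have := h _ (Or.inl (Or.inl (Or.inr ⟨b, c, hbc, rfl⟩)))
      simpa using this
    · have := h _ (Or.inl (Or.inr ⟨b, c, rfl⟩))
      simpa [sub_eq_zero] using this
    · have := h _ (Or.inr ⟨j, rfl⟩)
      rwa [hdet] at this
  · rintro ⟨h₁, h₂, h₃, h₄⟩ f
      (((⟨b, k, l, rfl⟩ | ⟨b, c, hbc, rfl⟩) | ⟨b, c, rfl⟩) | ⟨j, rfl⟩)
    · simp [hcontr, h₁ b k l]
    · simpa using h₂ b c hbc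
    · simpa [sub_eq_zero] using h₃ b c
    · rw [hdet, h₄]

/-- Outside of a hypersurface that does not contain the base tensor, every column of an orthogonal
matrix of eigenvectors of a pairwise mean independent tensor is a multiple of a unit vector. -/
theorem exists_polynomial_column {n e : ℕ} (he : e ≠ 0) (a : Fin n) :
    ∃ p : MvPolynomial (Fin (e + 2) → Fin n) ℝ, eval (diagTensor (baseWeight e)) p ≠ 0 ∧
      ∀ T : Tensor n (e + 2), (∀ k j, k ≠ j → T (Fin.cons k fun _ => j) = 0) → eval T p ≠ 0 →
        ∀ Q : Matrix (Fin n) (Fin n) ℝ, Q.transpose * Q = 1 →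
          (∀ b k l, Q k b * contr T (fun i => Q i b) l = Q l b * contr T (fun i => Q i b) k) →
          ∃ j, ∀ l, l ≠ j → Q l a = 0 := by
  obtain ⟨p, hp₀, hp⟩ := exists_eliminant (eigenbasisSystem n e a)
    (fun f hf => isHomogeneous_of_mem_eigenbasisSystem hf) (baseTensor n e) fun Q hQ => by
      obtain ⟨h₁, h₂, h₃, h₄⟩ := (eval_eigenbasisSystem_eq_zero_iff a _ Q).1 hQ
      exact eq_zero_of_baseTensor he Q a h₁ h₂ h₃ h₄
  have hbase : baseTensor n e = fun i => ((diagTensor (baseWeight e) i : ℝ) : ℂ) := by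
    funext i
    simp only [baseTensor, diagTensor]
    split_ifs <;> simp
  obtain ⟨q, hq₀, hq⟩ := exists_real_of_eval_ne_zero p (diagTensor (baseWeight e)) (hbase ▸ hp₀)
  refine ⟨q, hq₀, fun T hT hTq Q hQ heig => ?_⟩
  by_contra! hcol
  have hcontr : ∀ b k, contr (fun i => (T i : ℂ)) (fun i => (Q i b : ℂ)) k =
      ((contr T (fun i => Q i b) k : ℝ) : ℂ) := fun b k =>
    (map_contr Complex.ofRealHom T (fun i => Q i b) k).symm
  have hQQ : ∀ b c, ∑ i, (Q i b : ℂ) * Q i c = if b = c then 1 else 0 := fun b c => by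
    have := congrFun (congrFun hQ b) c
    simp only [Matrix.mul_apply, Matrix.transpose_apply, Matrix.one_apply] at this
    have := congrArg (fun x : ℝ => (x : ℂ)) this
    push_cast at this
    rw [this]
    split_ifs <;> simp
  have hzero := hp (fun i => (T i : ℂ)) (fun x => (Q x.1 x.2 : ℂ)) (hq T hTq)
    ((eval_eigenbasisSystem_eq_zero_iff a _ _).2 ⟨fun b k l => ?_, fun b c hbc => ?_,
      fun b c => ?_, fun j => ?_⟩)
  · obtain ⟨l, -, hl⟩ := hcol a
    have := congrFun hzero (l, a)
    exact hl (by simpa using this)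
  · simp only [hcontr]
    exact_mod_cast heig b k l
  · simp [hQQ, hbc]
  · simp [hQQ]
  · have := map_det_saturationMatrix Complex.ofRealHom T (fun i => Q i a) j
    rw [det_saturationMatrix_eq_zero T (fun i => Q i a) j (fun k hk => hT k j hk) (heig a) (hcol j),
      map_zero] at this
    exact this.symm

theorem exists_polynomial {n e : ℕ} (he : e ≠ 0) :
    ∃ p : MvPolynomial (Fin (e + 2) → Fin n) ℝ, eval (diagTensor (baseWeight e)) p ≠ 0 ∧
      ∀ T : Tensor n (e + 2), (∀ k j, k ≠ j → T (Fin.cons k fun _ => j) = 0) → eval T p ≠ 0 →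
        ∀ Q : Matrix (Fin n) (Fin n) ℝ, Q.transpose * Q = 1 →
          (∀ b k l, Q k b * contr T (fun i => Q i b) l = Q l b * contr T (fun i => Q i b) k) →
          ∀ a, ∃ j, ∀ l, l ≠ j → Q l a = 0 := by
  choose p hp₀ hp using fun a : Fin n => exists_polynomial_column he a
  refine ⟨∏ a, p a, ?_, fun T hT hTp Q hQ heig a => ?_⟩
  · rw [map_prod]
    exact Finset.prod_ne_zero_iff.2 fun a _ => hp₀ a
  · rw [map_prod] at hTp
    exact hp a T hT (Finset.prod_ne_zero_iff.1 hTp a (Finset.mem_univ a)) Q hQ heig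

end Generic

/-! ### From eigenbases to identifiability -/

theorem diagTensor_mem_diagSpace {n e : ℕ} (w : Fin n → ℝ) :
    (diagTensor w : Tensor n (e + 2)) ∈ diagSpace n (e + 2) := by
  have hiff : ∀ i : Fin (e + 2) → Fin n, (∀ m, i m = i 0) ↔ ∀ k l, i k = i l := fun i =>
    ⟨fun h k l => (h k).trans (h l).symm, fun h m => h m 0⟩
  refine ⟨fun σ i => ?_, fun i hi => ?_⟩
  · simp only [diagTensor, Function.comp_apply]
    by_cases h : ∀ m, i m = i 0
    · rw [if_pos h, if_pos fun m => (h _).trans (h _).symm, h]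
    · rw [if_neg h, if_neg]
      intro h'
      refine h fun m => ?_
      have h₁ := h' (σ.symm m)
      have h₂ := h' (σ.symm 0)
      rw [σ.apply_symm_apply] at h₁ h₂
      exact h₁.trans h₂.symm
  · refine (hiff i).1 ?_
    by_contra h
    exact hi (if_neg h)

theorem pmiIndex_eq_cons {n e : ℕ} (i j : Fin n) :
    pmiIndex (e + 2) i j = Fin.cons i fun _ => j := by
  funext m
  refine Fin.cases ?_ (fun m => ?_) m <;> simp [pmiIndex]

theorem tensorAct_cons {n e : ℕ} (M : Matrix (Fin n) (Fin n) ℝ) (T : Tensor n (e + 2))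
    (a b : Fin n) :
    tensorAct M T (Fin.cons a fun _ => b) = ∑ k, M a k * contr T (fun i => M b i) k := by
  rw [tensorAct, ← (Fin.consEquiv fun _ : Fin (e + 2) => Fin n).sum_comp, Fintype.sum_prod_type]
  refine Finset.sum_congr rfl fun k _ => ?_
  rw [contr, Finset.mul_sum]
  refine Finset.sum_congr rfl fun i _ => ?_
  simp [Fin.consEquiv, Fin.prod_univ_succ (n := e + 1)]
  ring

/-- The rows of an orthogonal matrix that moves `T` into the space of pairwise mean independent
tensors are eigenvectors of `T`. -/
theorem eigenvector_of_tensorAct_mem_pmiSpace {n e : ℕ} (M : Matrix (Fin n) (Fin n) ℝ)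
    (hM : M.transpose * M = 1) (T : Tensor n (e + 2))
    (hT : tensorAct M T ∈ pmiSpace n (e + 2)) (b k l : Fin n) :
    M b k * contr T (fun i => M b i) l = M b l * contr T (fun i => M b i) k := by
  have hrow : ∀ a, a ≠ b → ∑ k, M a k * contr T (fun i => M b i) k = 0 := fun a hab => by
    have := hT.2 a b hab
    rwa [pmiIndex_eq_cons, tensorAct_cons] at this
  set c := contr T (fun i => M b i) with hc
  -- By `hrow`, `M c` is a multiple of `e_b`; applying `Mᵀ` makes `c` a multiple of row `b`.
  have hval : ∀ m, c m = M b m * ∑ k, M b k * c k := fun m => by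
    have h : c m = (M.transpose.mulVec (M.mulVec c)) m := by
      rw [Matrix.mulVec_mulVec, hM, Matrix.one_mulVec]
    rw [h]
    simp only [Matrix.mulVec, dotProduct, Matrix.transpose_apply]
    refine Finset.sum_eq_single b (fun a _ hab => ?_) (by simp)
    rw [hrow a hab, mul_zero]
  rw [hval l, hval k]
  ring

/-- An orthogonal matrix with at most one nonzero entry in each column is a signed permutation. -/
theorem eqUpToSignedPerm_of_columns {n : ℕ} (A Q : Matrix (Fin n) (Fin n) ℝ)
    (hQ : Q.transpose * Q = 1) (h : ∀ a, ∃ j, ∀ l, l ≠ j → Q l a = 0) :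
    EqUpToSignedPerm A (A * Q) := by
  choose f hf using h
  have hQQ : ∀ a b, Q (f a) a * Q (f a) b = if a = b then 1 else 0 := fun a b => by
    have := congrFun (congrFun hQ a) b
    rw [Matrix.mul_apply, Matrix.one_apply, Finset.sum_eq_single (f a)] at this
    · exact this
    · intro l _ hl
      rw [Matrix.transpose_apply, hf a l hl, zero_mul]
    · simp
  have hinj : Function.Injective f := fun a b hab => by
    by_contra hne
    have h₁ := hQQ a b
    have h₂ := hQQ a a
    have h₃ := hQQ b b
    rw [if_neg hne] at h₁
    rw [if_pos rfl] at h₂ h₃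
    rw [← hab] at h₃
    rcases mul_eq_zero.1 h₁ with h | h
    · simp [h] at h₂
    · simp [h] at h₃
  refine ⟨Equiv.ofBijective f (Finite.injective_iff_bijective.1 hinj), fun a => Q (f a) a,
    fun a => ?_, fun i a => ?_⟩
  · have := hQQ a a
    rw [if_pos rfl] at this
    exact mul_self_eq_one_iff.1 this
  · rw [Matrix.mul_apply, Finset.sum_eq_single (f a), mul_comm]
    · rfl
    · intro l _ hl
      rw [hf a l hl, mul_zero]
    · simp

end ComponentAnalysis

open ComponentAnalysis in
theorem theorem1p3 (n d : ℕ) (hd : 3 ≤ d) (V : Submodule ℝ (Tensor n d))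
    (hdiag : diagSpace n d ≤ V) (hpmi : V ≤ pmiSpace n d) :
    ForGeneric V fun T =>
      ∀ (Ω : Type*) [MeasurableSpace Ω] (μ : Measure Ω) [IsProbabilityMeasure μ]
        (s : Ω → Fin n → ℝ) (A : Matrix (Fin n) (Fin n) ℝ),
        IsSource V μ s → cumulant d μ s = T → IsUnit A →
      ∀ (Ω' : Type*) [MeasurableSpace Ω'] (μ' : Measure Ω') [IsProbabilityMeasure μ']
        (s' : Ω' → Fin n → ℝ) (B : Matrix (Fin n) (Fin n) ℝ),
        IsSource V μ' s' → IsUnit B →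
        covMatrix μ' (fun ω => B.mulVec (s' ω)) = covMatrix μ (fun ω => A.mulVec (s ω)) →
        cumulant d μ' (fun ω => B.mulVec (s' ω)) = cumulant d μ (fun ω => A.mulVec (s ω)) →
        EqUpToSignedPerm A B := by
  obtain ⟨e, rfl⟩ : ∃ e, d = e + 2 := ⟨d - 2, by omega⟩
  obtain ⟨p, hp₀, hp⟩ := exists_polynomial (n := n) (e := e) (by omega)
  -- The base tensor witnesses that `p` is not identically zero on `V`.
  refine ⟨p, ⟨_, hdiag (diagTensor_mem_diagSpace _), hp₀⟩, fun T hTV hTp => ?_⟩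
  intro Ω _ μ _ s A hs hsT hA Ω' _ μ' _ s' B hs' hB hcov hcum
  have htwo : (2 : ENNReal) ≤ ((e + 2 : ℕ) : ENNReal) := by exact_mod_cast Nat.le_add_left 2 e
  rw [covMatrix_mulVec μ' B s' fun i => (hs'.memLp i).mono_exponent htwo,
    covMatrix_mulVec μ A s fun i => (hs.memLp i).mono_exponent htwo, hs.cov_eq_one,
    hs'.cov_eq_one, mul_one, mul_one] at hcov
  rw [cumulant_mulVec μ' B s' hs'.memLp, cumulant_mulVec μ A s hs.memLp, hsT] at hcum
  have hA' := (Matrix.isUnit_iff_isUnit_det A).1 hA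
  have hB' := (Matrix.isUnit_iff_isUnit_det B).1 hB
  have hQ : (A⁻¹ * B) * (A⁻¹ * B).transpose = 1 := by
    rw [Matrix.transpose_mul, Matrix.mul_assoc, ← Matrix.mul_assoc B, hcov, Matrix.mul_assoc A,
      ← Matrix.transpose_mul, Matrix.nonsing_inv_mul A hA', Matrix.transpose_one, mul_one,
      Matrix.nonsing_inv_mul A hA']
  have hinv : B⁻¹ * A = (A⁻¹ * B).transpose := by
    have : (B⁻¹ * A) * (A⁻¹ * B) = 1 := by
      rw [Matrix.mul_assoc, ← Matrix.mul_assoc A, Matrix.mul_nonsing_inv A hA', one_mul,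
        Matrix.nonsing_inv_mul B hB']
    exact left_inv_eq_right_inv this hQ
  have hact : tensorAct (A⁻¹ * B).transpose T = cumulant (e + 2) μ' s' := by
    rw [← hinv, ← tensorAct_tensorAct, ← hcum, tensorAct_tensorAct,
      Matrix.nonsing_inv_mul B hB', tensorAct_one]
  have hcols := hp T
    (fun k j hkj => by
      have := (hpmi hTV).2 k j hkj
      rwa [pmiIndex_eq_cons] at this)
    hTp (A⁻¹ * B) (mul_eq_one_comm.1 hQ)
    (eigenvector_of_tensorAct_mem_pmiSpace (A⁻¹ * B).transpose (by simpa using hQ) T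
      (hact ▸ hpmi hs'.cumulant_mem))
  have := eqUpToSignedPerm_of_columns A (A⁻¹ * B) (mul_eq_one_comm.1 hQ) hcols
  rwa [← Matrix.mul_assoc, Matrix.mul_nonsing_inv A hA', one_mul] at this
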